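/- All compact spaces are assumed Hausdorff; a continuum is a (non-empty) connected compact Hausdorff space. For a space $X$ let $w(X)$ denote its weight, the least cardinality of a base of its topology. For a continuum $Y$ let $\mathrm{Sln}(Y)$ be the supremum of the cardinalities of families of pairwise disjoint non-degenerate (i.e. having more than one point) subcontinua of $Y$, and for a compact space $X$ let $\mathrm{Sln}(X)$ be the minimum of $\mathrm{Sln}(Y)$ over all continua $Y$ containing a homeomorphic copy of $X$. A map is called monotone if it is continuous and all its point preimages are connected (in particular non-empty, so that the map is surjective). Theorem. Let $X$ be a compact space with more than one point such that $w(X)>\mathrm{Sln}(X)$. Then $X$ is homeomorphic to the limit of a well-ordered inverse spectrum $\{Z_\alpha,\pi_\alpha^\beta:\alpha\le\beta<\mathrm{Sln}(X)^+\}$, indexed by the ordinals less than the successor cardinal $\mathrm{Sln}(X)^+$, in which every $Z_\alpha$ is a compact Hausdorff space of weight $w(Z_\alpha)\le\mathrm{Sln}(X)$ and every bonding map $\pi_\alpha^\beta:Z_\beta\to Z_\alpha$ is monotone. -/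

import Mathlib

open Cardinal Ordinal Topology

universe u v

/-- The weight `w(X)`: the least cardinality of a base of the topology. -/
noncomputable def topWeight (X : Type u) [TopologicalSpace X] : Cardinal.{u} :=
  sInf {c | ∃ B : Set (Set X), TopologicalSpace.IsTopologicalBasis B ∧ #B = c}

/-- A disjoint family of non-degenerate subcontinua of a Hausdorff space `Y`: pairwise disjoint
compact connected subsets, each with at least two points. -/
structure IsDisjointContinuumFamily {Y : Type u} [TopologicalSpace Y] (C : Set (Set Y)) :
    Prop where
  isCompact : ∀ K ∈ C, IsCompact K
  isConnected : ∀ K ∈ C, IsConnected K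
  nontrivial : ∀ K ∈ C, K.Nontrivial
  disjoint : C.PairwiseDisjoint id

/-- The Suslinian number of a continuum `Y`: the supremum of the cardinalities of disjoint
families of non-degenerate subcontinua of `Y`. -/
noncomputable def continuumSln (Y : Type u) [TopologicalSpace Y] : Cardinal.{u} :=
  sSup {c | ∃ C : Set (Set Y), IsDisjointContinuumFamily C ∧ #C = c}

/-- The supremum defining `continuumSln` is taken over a bounded set of cardinals. -/
theorem bddAbove_continuumSln (Y : Type u) [TopologicalSpace Y] :
    BddAbove {c | ∃ C : Set (Set Y), IsDisjointContinuumFamily C ∧ #C = c} :=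
  ⟨#(Set Y), by rintro c ⟨C, -, rfl⟩; exact mk_set_le C⟩

/-- The Suslinian numbers of the continua (non-empty connected compact Hausdorff spaces) that
contain a homeomorphic copy of `X`. -/
def slnSet (X : Type u) [TopologicalSpace X] : Set Cardinal.{u} :=
  {c | ∃ (Y : Type u) (_ : TopologicalSpace Y) (_ : CompactSpace Y) (_ : T2Space Y)
    (_ : ConnectedSpace Y) (e : X → Y), IsEmbedding e ∧ continuumSln Y = c}

/-- The Suslinian number `Sln(X)` of a Tychonoff space `X`: the least Suslinian number of a
continuum containing `X`. -/
noncomputable def Sln (X : Type u) [TopologicalSpace X] : Cardinal.{u} :=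
  sInf (slnSet X)

/-- Every compact Hausdorff space embeds in a continuum (a Tychonoff cube), so the minimum that
defines `Sln X` is attained. -/
theorem slnSet_nonempty (X : Type u) [TopologicalSpace X] [CompactSpace X] [T2Space X] :
    (slnSet X).Nonempty := by
  refine ⟨_, C(X, unitInterval) → unitInterval, inferInstance, inferInstance, inferInstance,
    inferInstance, fun x f => f x, ?_, rfl⟩
  have hc : Continuous (fun (x : X) (f : C(X, unitInterval)) => f x) :=
    continuous_pi fun f => f.continuous
  refine (hc.isClosedEmbedding ?_).isEmbedding
  intro x y hxy
  by_contra hne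
  obtain ⟨f, hf, hx, hy⟩ := CompletelyRegularSpace.completely_regular x {y} isClosed_singleton
    (by simpa using hne)
  have h1 := congrFun hxy ⟨f, hf⟩
  have h2 : f y = 1 := hy rfl
  simp [hx, h2] at h1

/-- A monotone map: a continuous map all of whose point preimages are connected
(in particular non-empty). -/
structure IsMonotoneMap {X : Type u} {Y : Type v} [TopologicalSpace X] [TopologicalSpace Y]
    (f : X → Y) : Prop where
  continuous : Continuous f
  isConnected_fiber : ∀ y, IsConnected (f ⁻¹' {y})

/-- An inverse spectrum `{Z_α, π_α^β : α ≤ β}` of topological spaces and continuous bonding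
maps `π_α^β : Z_β → Z_α`, indexed by a preordered set. -/
structure InverseSpectrum (ι : Type v) [Preorder ι] where
  space : ι → Type u
  [topology : ∀ α, TopologicalSpace (space α)]
  bond : ∀ ⦃α β : ι⦄, α ≤ β → space β → space α
  continuous_bond : ∀ ⦃α β : ι⦄ (h : α ≤ β), Continuous (bond h)
  bond_self : ∀ (α : ι) (z : space α), bond (le_refl α) z = z
  bond_bond : ∀ ⦃α β γ : ι⦄ (h : α ≤ β) (h' : β ≤ γ) (z : space γ),
    bond h (bond h' z) = bond (h.trans h') z

attribute [instance] InverseSpectrum.topology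

/-- The limit of an inverse spectrum: the subspace of the product formed by the threads. -/
def InverseSpectrum.limit {ι : Type v} [Preorder ι] (S : InverseSpectrum.{u, v} ι) :
    Set (∀ α, S.space α) :=
  {z | ∀ ⦃α β : ι⦄ (h : α ≤ β), S.bond h (z β) = z α}

/-! Embed X in a continuum Y realizing κ = Sln(X). A set G of at most κ real functions decomposes X
into the components of the fibres of its diagonal map; the spectrum consists of quotients by such
decompositions. The nondegenerate classes are disjoint continua in Y, so at most κ further functions
break all of them (`exists_splitting_functions`). Iterating κ⁺ times separates points: otherwise the
shrinking classes of an unseparated pair would shed κ⁺ disjoint nondegenerate continua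
(`exists_separating_chain`).

The hard point is that each quotient is Hausdorff of weight at most κ
(`exists_saturated_separating_family`). One-point classes are not counted by κ, so components are
counted in Y instead: by boundary bumping, at most κ components of a closed set meet a given open
subset of it (`mk_components_le`). X need not be an intersection of κ neighbourhoods in Y, but a
maximal disjoint family of continua off X yields at most κ closed neighbourhoods of X such that
every nondegenerate continuum in their intersection lies in X, and this suffices. -/

theorem IsDisjointContinuumFamily.mk_le_continuumSln {Y : Type u} [TopologicalSpace Y]
    {C : Set (Set Y)} (hC : IsDisjointContinuumFamily C) : #C ≤ continuumSln Y :=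
  le_csSup (bddAbove_continuumSln Y) ⟨C, hC, rfl⟩

/-- An indexed family of disjoint nondegenerate continua in a subspace of `Y` has at most
`continuumSln Y` members. -/
theorem mk_le_continuumSln_of_disjoint {X Y ι : Type u} [TopologicalSpace X] [TopologicalSpace Y]
    {e : X → Y} (he : Continuous e) (hinj : Function.Injective e) (L : ι → Set X)
    (hc : ∀ i, IsCompact (L i)) (hconn : ∀ i, IsConnected (L i)) (hn : ∀ i, (L i).Nontrivial)
    (hd : Pairwise fun i j => Disjoint (L i) (L j)) : #ι ≤ continuumSln Y := by
  have hd' : Pairwise fun i j => Disjoint (e '' L i) (e '' L j) := fun i j hij =>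
    (Set.disjoint_image_iff hinj).2 (hd hij)
  have hi : Function.Injective fun i => e '' L i := by
    intro i j hij
    by_contra hne
    have h : Disjoint (e '' L i) (e '' L j) := hd' hne
    simp only at hij
    rw [hij, disjoint_self] at h
    exact ((hn j).nonempty.image e).ne_empty h
  rw [← mk_range_eq _ hi]
  refine IsDisjointContinuumFamily.mk_le_continuumSln ⟨?_, ?_, ?_, ?_⟩
  · rintro _ ⟨i, rfl⟩; exact (hc i).image he
  · rintro _ ⟨i, rfl⟩; exact (hconn i).image e he.continuousOn
  · rintro _ ⟨i, rfl⟩; exact (hn i).image hinj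
  · rintro _ ⟨i, rfl⟩ _ ⟨j, rfl⟩ hij
    exact hd' fun h => hij (by rw [h])

/-! ### Components of compact sets and boundary bumping -/

theorem isCompact_connectedComponentIn {Y : Type u} [TopologicalSpace Y] {K : Set Y}
    (hK : IsCompact K) (x : Y) : IsCompact (connectedComponentIn K x) := by
  by_cases hx : x ∈ K
  · have := isCompact_iff_compactSpace.1 hK
    rw [connectedComponentIn_eq_image hx]
    exact isClosed_connectedComponent.isCompact.image continuous_subtype_val
  · rw [connectedComponentIn_eq_empty hx]; exact isCompact_empty

theorem exists_isClopen_of_connectedComponent_subset {Y : Type u} [TopologicalSpace Y]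
    [CompactSpace Y] [T2Space Y] {x : Y} {U : Set Y} (hU : IsOpen U)
    (h : connectedComponent x ⊆ U) : ∃ Z, IsClopen Z ∧ x ∈ Z ∧ Z ⊆ U := by
  rw [connectedComponent_eq_iInter_isClopen] at h
  have : Nonempty { s : Set Y // IsClopen s ∧ x ∈ s } := ⟨⟨Set.univ, isClopen_univ, trivial⟩⟩
  obtain ⟨⟨Z, hZ, hx⟩, hZU⟩ := exists_subset_nhds_of_isCompact
    (V := fun s : { s : Set Y // IsClopen s ∧ x ∈ s } => s.1)
    (fun s t => ⟨⟨s.1 ∩ t.1, s.2.1.inter t.2.1, s.2.2, t.2.2⟩,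
      Set.inter_subset_left, Set.inter_subset_right⟩)
    (fun s => s.2.1.isClosed.isCompact) (fun y hy => hU.mem_nhds (h hy))
  exact ⟨Z, hZ, hx, hZU⟩

/-- A compact set splits into two closed pieces around a connected component. -/
theorem exists_closed_split {Y : Type u} [TopologicalSpace Y] [T2Space Y] {K : Set Y}
    (hK : IsCompact K) {x : Y} (hx : x ∈ K) {U : Set Y} (hU : IsOpen U)
    (h : connectedComponentIn K x ⊆ U) :
    ∃ A B, IsClosed A ∧ IsClosed B ∧ Disjoint A B ∧ A ∪ B = K ∧ x ∈ A ∧ A ⊆ U := by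
  have := isCompact_iff_compactSpace.1 hK
  rw [connectedComponentIn_eq_image hx, Set.image_subset_iff] at h
  obtain ⟨Z, hZ, hxZ, hZU⟩ :=
    exists_isClopen_of_connectedComponent_subset (hU.preimage continuous_subtype_val) h
  have hemb := hK.isClosed.isClosedEmbedding_subtypeVal
  refine ⟨(↑) '' Z, (↑) '' Zᶜ, hemb.isClosedMap _ hZ.isClosed, hemb.isClosedMap _
    hZ.compl.isClosed, (Set.disjoint_image_iff Subtype.val_injective).2 disjoint_compl_right, ?_,
    ⟨⟨x, hx⟩, hxZ, rfl⟩, Set.image_subset_iff.2 hZU⟩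
  rw [← Set.image_union, Set.union_compl_self, Set.image_univ, Subtype.range_coe]

/-- Boundary bumping: a component of a relative closed neighbourhood of one of its points in a
nondegenerate continuum is nondegenerate. -/
theorem nontrivial_connectedComponentIn {Y : Type u} [TopologicalSpace Y] [T2Space Y]
    {K T U : Set Y} (hK : IsCompact K) (hKc : IsPreconnected K) (hKn : K.Nontrivial)
    (hT : IsClosed T) (hU : IsOpen U) (hUT : U ⊆ T) {p : Y} (hpK : p ∈ K) (hpU : p ∈ U) :
    (connectedComponentIn (K ∩ T) p).Nontrivial := by
  have hpN : p ∈ K ∩ T := ⟨hpK, hUT hpU⟩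
  by_contra hnt
  rw [Set.not_nontrivial_iff] at hnt
  obtain ⟨q, hq, hqp⟩ := hKn.exists_ne p
  -- Removing `q` ensures that `K` is not contained in the open set that will isolate `A`.
  have hsub : connectedComponentIn (K ∩ T) p ⊆ U \ {q} := by
    intro y hy
    rw [hnt hy (mem_connectedComponentIn hpN)]
    exact ⟨hpU, fun h => hqp h.symm⟩
  have hV : IsOpen (U \ {q}) := hU.sdiff isClosed_singleton
  obtain ⟨A, B, hA, hB, hAB, hun, hpA, hAV⟩ :=
    exists_closed_split (hK.inter_right hT) hpN hV hsub
  obtain ⟨y, -, hyA, hy⟩ := isPreconnected_closed_iff.1 hKc A (B ∪ (U \ {q})ᶜ) hA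
    (hB.union hV.isClosed_compl) (by
      intro y hy
      by_cases hyV : y ∈ U \ {q}
      · have : y ∈ A ∪ B := hun ▸ ⟨hy, hUT hyV.1⟩
        exact this.imp id Or.inl
      · exact Or.inr (Or.inr hyV)) ⟨p, hpK, hpA⟩ ⟨q, hq, Or.inr fun h => h.2 rfl⟩
  exact hy.elim (fun h => Set.disjoint_left.1 hAB hyA h) fun h => h (hAV hyA)

theorem exists_subcontinuum_subset {Y : Type u} [TopologicalSpace Y] [T2Space Y] [RegularSpace Y]
    {K U : Set Y} (hK : IsCompact K) (hKc : IsPreconnected K) (hKn : K.Nontrivial)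
    (hU : IsOpen U) (hKU : (K ∩ U).Nonempty) :
    ∃ L ⊆ K ∩ U, IsCompact L ∧ IsConnected L ∧ L.Nontrivial := by
  obtain ⟨p, hpK, hpU⟩ := hKU
  obtain ⟨T, hTn, hT, hTU⟩ := exists_mem_nhds_isClosed_subset (hU.mem_nhds hpU)
  have hn := nontrivial_connectedComponentIn hK hKc hKn hT isOpen_interior interior_subset hpK
    (mem_interior_iff_mem_nhds.2 hTn)
  exact ⟨connectedComponentIn (K ∩ T) p,
    (connectedComponentIn_subset _ _).trans (Set.inter_subset_inter_right K hTU),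
    isCompact_connectedComponentIn (hK.inter_right hT) p,
    ⟨hn.nonempty, isPreconnected_connectedComponentIn⟩, hn⟩

/-- Any n points have disjoint neighbourhoods, each containing a nondegenerate continuum. Infinity
of κ is what makes κ · κ = κ available throughout. -/
theorem aleph0_le_continuumSln (Y : Type u) [TopologicalSpace Y] [CompactSpace Y] [T2Space Y]
    [ConnectedSpace Y] [Nontrivial Y] : ℵ₀ ≤ continuumSln Y := by
  rw [aleph0_le]
  intro n
  have hinf : Infinite Y := Set.infinite_univ_iff.mp <|
    isPreconnected_univ.infinite_of_nontrivial Set.nontrivial_univ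
  obtain ⟨t, ht⟩ := Infinite.exists_subset_card_eq Y n
  obtain ⟨U, hU, hd⟩ := t.finite_toSet.t2_separation
  have hL : ∀ p : t, ∃ L ⊆ Set.univ ∩ U p, IsCompact L ∧ IsConnected L ∧ L.Nontrivial := fun p =>
    exists_subcontinuum_subset isCompact_univ isPreconnected_univ Set.nontrivial_univ
      (hU p).2 ⟨p, trivial, (hU p).1⟩
  choose L hLU hLc hLconn hLn using hL
  have := mk_le_continuumSln_of_disjoint (continuous_id (X := Y)) Function.injective_id L hLc
    hLconn hLn fun p q hpq => (hd p.2 q.2 fun h => hpq (Subtype.ext h)).mono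
      ((hLU p).trans Set.inter_subset_right) ((hLU q).trans Set.inter_subset_right)
  simpa [ht] using this

/-! ### Decompositions into components of fibres -/

/-- The decomposition of `X` into the components of the fibres of the diagonal map of a family `G`
of real-valued functions. -/
def componentSetoid {X : Type u} [TopologicalSpace X] (G : Set C(X, ℝ)) : Setoid X where
  r x y := ∃ C : Set X, IsPreconnected C ∧ x ∈ C ∧ y ∈ C ∧ ∀ g ∈ G, ∀ z ∈ C, g z = g x
  iseqv :=
    { refl := fun x => ⟨{x}, isPreconnected_singleton, rfl, rfl, by
        rintro g - z rfl; rfl⟩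
      symm := by
        rintro x y ⟨C, hC, hx, hy, h⟩
        exact ⟨C, hC, hy, hx, fun g hg z hz => (h g hg z hz).trans (h g hg y hy).symm⟩
      trans := by
        rintro x y z ⟨C, hC, hx, hy, h⟩ ⟨D, hD, hy', hz, h'⟩
        refine ⟨C ∪ D, hC.union y hy hy' hD, Or.inl hx, Or.inr hz, ?_⟩
        rintro g hg w (hw | hw)
        · exact h g hg w hw
        · exact (h' g hg w hw).trans (h g hg y hy) }

/-- The class of `x` in `componentSetoid G`. -/
def componentClass {X : Type u} [TopologicalSpace X] (G : Set C(X, ℝ)) (x : X) : Set X :=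
  {y | componentSetoid G x y}

section componentClass

variable {X : Type u} [TopologicalSpace X] {G G' : Set C(X, ℝ)} {x y : X}

theorem componentSetoid_anti (h : G ⊆ G') (hxy : componentSetoid G' x y) :
    componentSetoid G x y := by
  obtain ⟨C, hC, hx, hy, hg⟩ := hxy
  exact ⟨C, hC, hx, hy, fun g hgG => hg g (h hgG)⟩

theorem componentSetoid_apply_eq (h : componentSetoid G x y) {g : C(X, ℝ)} (hg : g ∈ G) :
    g y = g x := by
  obtain ⟨C, hC, hx, hy, hgC⟩ := h
  exact hgC g hg y hy

theorem mem_componentClass_self : x ∈ componentClass G x := (componentSetoid G).refl x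

theorem isConnected_componentClass : IsConnected (componentClass G x) := by
  refine ⟨⟨x, mem_componentClass_self⟩, isPreconnected_of_forall x ?_⟩
  rintro y ⟨C, hC, hx, hy, hg⟩
  exact ⟨C, fun z hz => ⟨C, hC, hx, hz, hg⟩, hx, hy, hC⟩

theorem isClosed_componentClass : IsClosed (componentClass G x) := by
  refine isClosed_of_closure_subset fun y hy => ⟨closure (componentClass G x),
    isConnected_componentClass.isPreconnected.closure, subset_closure mem_componentClass_self, hy,
    fun g hg => ?_⟩
  have hcl : IsClosed {z | g z = g x} := isClosed_eq g.continuous continuous_const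
  exact closure_minimal (fun z hz => componentSetoid_apply_eq hz hg) hcl

end componentClass

/-! ### Closed splittings and cardinal arithmetic -/

theorem IsPreconnected.subset_left_of_subset_union_closed {Y : Type u} [TopologicalSpace Y]
    {D A B : Set Y} (hD : IsPreconnected D) (hA : IsClosed A) (hB : IsClosed B)
    (hAB : Disjoint A B) (hDAB : D ⊆ A ∪ B) (hDA : (D ∩ A).Nonempty) : D ⊆ A := by
  rcases isPreconnected_iff_subset_of_disjoint_closed.1 hD A B hA hB hDAB
    (by rw [hAB.inter_eq, Set.inter_empty]) with h | h
  · exact h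
  · obtain ⟨y, hy, hyA⟩ := hDA
    exact (Set.disjoint_left.1 hAB hyA (h hy)).elim

theorem Cardinal.mk_sigma_le_of_le {ι : Type u} {f : ι → Type u} {κ : Cardinal.{u}} (hκ : ℵ₀ ≤ κ)
    (hι : #ι ≤ κ) (hf : ∀ i, #(f i) ≤ κ) : #(Σ i, f i) ≤ κ := by
  rw [mk_sigma]
  calc Cardinal.sum (fun i => #(f i)) ≤ Cardinal.sum fun _ : ι => κ := sum_le_sum _ _ hf
    _ = #ι * κ := sum_const' _ _
    _ ≤ κ := mul_le_of_le hκ hι le_rfl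

theorem Cardinal.mk_iUnion_le_of_le {α ι : Type u} {f : ι → Set α} {κ : Cardinal.{u}} (hκ : ℵ₀ ≤ κ)
    (hι : #ι ≤ κ) (hf : ∀ i, #(f i) ≤ κ) : #(⋃ i, f i) ≤ κ :=
  (mk_le_of_surjective (Set.sigmaToiUnion_surjective f)).trans (mk_sigma_le_of_le hκ hι hf)

theorem Cardinal.mk_finset_le_of_le {ι : Type u} {κ : Cardinal.{u}} (hκ : ℵ₀ ≤ κ)
    (hι : #ι ≤ κ) : #(Finset ι) ≤ κ := by
  rcases finite_or_infinite ι with h | h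
  · exact (lt_aleph0_of_finite _).le.trans hκ
  · rwa [mk_finset_of_infinite]

/-! ### Separating components in the continuum by few pieces -/

section

variable {Y : Type u} [TopologicalSpace Y] [CompactSpace Y] [T2Space Y]

/-- A splitting of the full intersection extends to disjoint open sets, and by compactness some
finite subintersection already lies in their union. -/
theorem exists_finset_notMem_connectedComponentIn {ι : Type u} {T : ι → Set Y}
    (hT : ∀ i, IsClosed (T i)) {J : Set ι} {x y : Y} (hx : ∀ i ∈ J, x ∈ T i)
    (hy : ∀ i ∈ J, y ∈ T i) (h : y ∉ connectedComponentIn (⋂ i ∈ J, T i) x) :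
    ∃ s : Finset ι, ↑s ⊆ J ∧ y ∉ connectedComponentIn (⋂ i ∈ s, T i) x := by
  have hF : IsClosed (⋂ i ∈ J, T i) := isClosed_biInter fun i _ => hT i
  obtain ⟨A, B, hA, hB, hAB, hun, hxA, hAy⟩ := exists_closed_split hF.isCompact
    (Set.mem_iInter₂.2 hx) (isOpen_compl_singleton (x := y))
    (fun z hz hzy => h (Set.mem_singleton_iff.1 hzy ▸ hz))
  have hyB : y ∈ B := by
    have : y ∈ A ∪ B := hun ▸ Set.mem_iInter₂.2 hy
    exact this.resolve_left fun h => hAy h rfl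
  obtain ⟨U, V, hU, hV, hAU, hBV, hUV⟩ := SeparatedNhds.of_isCompact_isCompact hA.isCompact
    hB.isCompact hAB
  obtain ⟨u, hu⟩ := (hU.union hV).isClosed_compl.isCompact.elim_finite_subfamily_closed
    (fun i : J => T i) (fun i => hT i) (by
      rw [← Set.disjoint_iff_inter_eq_empty, Set.disjoint_compl_left_iff_subset]
      rw [Set.biInter_eq_iInter] at hun
      rw [← hun]
      exact Set.union_subset_union hAU hBV)
  classical
  refine ⟨u.map (Function.Embedding.subtype _), by simp, fun hmem => ?_⟩
  have hTu : (⋂ i ∈ u.map (Function.Embedding.subtype _), T i) ⊆ U ∪ V := by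
    rw [← Set.disjoint_iff_inter_eq_empty, Set.disjoint_compl_left_iff_subset] at hu
    refine subset_trans (fun z hz => ?_) hu
    simp only [Finset.mem_map, Function.Embedding.subtype_apply, Set.mem_iInter] at hz ⊢
    exact fun i hi => hz i ⟨i, hi, rfl⟩
  have hxT : x ∈ ⋂ i ∈ u.map (Function.Embedding.subtype _), T i := by
    simp only [Finset.mem_map, Function.Embedding.subtype_apply, Set.mem_iInter]
    rintro _ ⟨i, -, rfl⟩
    exact hx i i.2
  have := isPreconnected_connectedComponentIn.subset_left_of_subset_union hU hV hUV
    ((connectedComponentIn_subset _ _).trans hTu)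
    ⟨x, mem_connectedComponentIn hxT, hAU hxA⟩ hmem
  exact Set.disjoint_left.1 hUV this (hBV hyB)

variable [ConnectedSpace Y] [Nontrivial Y]

/-- The components of a closed set meeting an open subset form a disjoint family of nondegenerate
continua. -/
theorem mk_components_le {T O : Set Y} (hT : IsClosed T) (hO : IsOpen O) (hOT : O ⊆ T) :
    #(connectedComponentIn T '' O : Set (Set Y)) ≤ continuumSln Y := by
  refine IsDisjointContinuumFamily.mk_le_continuumSln ⟨?_, ?_, ?_, ?_⟩
  · rintro _ ⟨x, hx, rfl⟩; exact isCompact_connectedComponentIn hT.isCompact x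
  · rintro _ ⟨x, hx, rfl⟩; exact isConnected_connectedComponentIn_iff.2 (hOT hx)
  · rintro _ ⟨x, hx, rfl⟩
    have := nontrivial_connectedComponentIn isCompact_univ isPreconnected_univ Set.nontrivial_univ
      hT hO hOT (Set.mem_univ x) hx
    rwa [Set.univ_inter] at this
  · rintro _ ⟨x, hx, rfl⟩ _ ⟨y, hy, rfl⟩ hne
    refine Set.disjoint_left.2 fun z hzx hzy => hne ?_
    rw [connectedComponentIn_eq hzx, connectedComponentIn_eq hzy]

/-- There are at most κ finite `s`, and for each at most κ components of the intersection of the `T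
i` meet that of the `O i`. One closed splitting per pair of such components therefore suffices. -/
theorem exists_clopen_piece_family {ι : Type u} (hι : #ι ≤ continuumSln Y) {T O : ι → Set Y}
    (hT : ∀ i, IsClosed (T i)) (hO : ∀ i, IsOpen (O i)) (hOT : ∀ i, O i ⊆ T i) :
    ∃ P : Set (Set Y), #P ≤ continuumSln Y ∧
      (∀ D ∈ P, ∃ (s : Finset ι) (A B : Set Y), IsClosed A ∧ IsClosed B ∧ Disjoint A B ∧
        A ∪ B = ⋂ i ∈ s, T i ∧ D = A ∩ ⋂ i ∈ s, O i) ∧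
      ∀ (J : Set ι) (x y : Y), (∀ i ∈ J, x ∈ O i) → (∀ i ∈ J, y ∈ O i) →
        y ∉ connectedComponentIn (⋂ i ∈ J, T i) x →
        ∃ D ∈ P, ∃ D' ∈ P, x ∈ D ∧ y ∈ D' ∧ Disjoint D D' := by
  have hκ := aleph0_le_continuumSln Y
  have hTs : ∀ s : Finset ι, IsClosed (⋂ i ∈ s, T i) := fun s => isClosed_biInter fun i _ => hT i
  have hOs : ∀ s : Finset ι, IsOpen (⋂ i ∈ s, O i) := fun s => isOpen_biInter_finset fun i _ => hO i
  have hOTs : ∀ s : Finset ι, (⋂ i ∈ s, O i) ⊆ ⋂ i ∈ s, T i := fun s =>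
    Set.iInter₂_mono fun i _ => hOT i
  let E : Finset ι → Set (Set Y) := fun s =>
    connectedComponentIn (⋂ i ∈ s, T i) '' (⋂ i ∈ s, O i)
  have hE : ∀ s, #(E s) ≤ continuumSln Y := fun s => mk_components_le (hTs s) (hOs s) (hOTs s)
  have hsplit : ∀ k : (Σ s : Finset ι, E s × E s), ∃ A B : Set Y, IsClosed A ∧ IsClosed B ∧
      Disjoint A B ∧ A ∪ B = (⋂ i ∈ k.1, T i) ∧
      (k.2.1 ≠ k.2.2 → k.2.1.1 ⊆ A ∧ k.2.2.1 ⊆ B) := by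
    rintro ⟨s, ⟨_, x, hx, rfl⟩, ⟨_, y, hy, rfl⟩⟩
    by_cases hne : connectedComponentIn (⋂ i ∈ s, T i) x = connectedComponentIn (⋂ i ∈ s, T i) y
    -- For equal components any splitting serves; the trivial one is a default.
    · exact ⟨∅, _, isClosed_empty, hTs s, Set.empty_disjoint _, Set.empty_union _,
        fun h => (h (Subtype.ext hne)).elim⟩
    · obtain ⟨A, B, hA, hB, hAB, hun, hxA, hAy⟩ := exists_closed_split (hTs s).isCompact
        (hOTs s hx) (isOpen_compl_singleton (x := y)) (fun z hz hzy => hne <|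
          connectedComponentIn_eq (Set.mem_singleton_iff.1 hzy ▸ hz))
      have hyB : y ∈ B := by
        have : y ∈ A ∪ B := hun ▸ hOTs s hy
        exact this.resolve_left fun h => hAy h rfl
      refine ⟨A, B, hA, hB, hAB, hun, fun _ => ⟨?_, ?_⟩⟩
      · exact isPreconnected_connectedComponentIn.subset_left_of_subset_union_closed hA hB hAB
          (hun ▸ connectedComponentIn_subset _ _) ⟨x, mem_connectedComponentIn (hOTs s hx), hxA⟩
      · exact isPreconnected_connectedComponentIn.subset_left_of_subset_union_closed hB hA
          hAB.symm (Set.union_comm A B ▸ hun ▸ connectedComponentIn_subset _ _)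
          ⟨y, mem_connectedComponentIn (hOTs s hy), hyB⟩
  choose A B hA hB hAB hun hsub using hsplit
  have hk : #(Σ s : Finset ι, E s × E s) ≤ continuumSln Y :=
    mk_sigma_le_of_le hκ (mk_finset_le_of_le hκ hι) fun s => by
      rw [mk_prod, Cardinal.lift_id]; exact mul_le_of_le hκ (hE s) (hE s)
  refine ⟨Set.range (fun k => A k ∩ ⋂ i ∈ k.1, O i) ∪ Set.range (fun k => B k ∩ ⋂ i ∈ k.1, O i),
    (mk_union_le _ _).trans (add_le_of_le hκ (mk_range_le.trans hk) (mk_range_le.trans hk)), ?_, ?_⟩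
  · rintro _ (⟨k, rfl⟩ | ⟨k, rfl⟩)
    · exact ⟨k.1, A k, B k, hA k, hB k, hAB k, hun k, rfl⟩
    · exact ⟨k.1, B k, A k, hB k, hA k, (hAB k).symm, Set.union_comm (A k) (B k) ▸ hun k, rfl⟩
  · intro J x y hx hy hxy
    obtain ⟨s, hsJ, hs⟩ := exists_finset_notMem_connectedComponentIn hT
      (fun i hi => hOT i (hx i hi)) (fun i hi => hOT i (hy i hi)) hxy
    have hxs : x ∈ ⋂ i ∈ s, O i := Set.mem_iInter₂.2 fun i hi => hx i (hsJ hi)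
    have hys : y ∈ ⋂ i ∈ s, O i := Set.mem_iInter₂.2 fun i hi => hy i (hsJ hi)
    let k : (Σ s : Finset ι, E s × E s) := ⟨s, ⟨_, x, hxs, rfl⟩, ⟨_, y, hys, rfl⟩⟩
    have hyy : y ∈ connectedComponentIn (⋂ i ∈ s, T i) y := mem_connectedComponentIn (hOTs s hys)
    have hxx : x ∈ connectedComponentIn (⋂ i ∈ s, T i) x := mem_connectedComponentIn (hOTs s hxs)
    have hne : k.2.1 ≠ k.2.2 := fun h => hs (by
      have h' : connectedComponentIn (⋂ i ∈ s, T i) x = connectedComponentIn (⋂ i ∈ s, T i) y :=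
        congrArg Subtype.val h
      rw [h']; exact hyy)
    exact ⟨_, Or.inl ⟨k, rfl⟩, _, Or.inr ⟨k, rfl⟩, ⟨(hsub k hne).1 hxx, hxs⟩,
      ⟨(hsub k hne).2 hyy, hys⟩, (hAB k).mono Set.inter_subset_left Set.inter_subset_left⟩

end

/-! ### Separating the classes in X -/

theorem exists_maximal_family_disjoint {Y : Type u} [TopologicalSpace Y] (S : Set Y) :
    ∃ M : Set (Set Y), IsDisjointContinuumFamily M ∧ (∀ K ∈ M, Disjoint K S) ∧
      ∀ L : Set Y, IsCompact L → IsConnected L → L.Nontrivial → Disjoint L S →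
        ∃ K ∈ M, (L ∩ K).Nonempty := by
  obtain ⟨M, hM⟩ := zorn_subset {C : Set (Set Y) | IsDisjointContinuumFamily C ∧
      ∀ K ∈ C, Disjoint K S} (by
    intro c hc hchain
    refine ⟨⋃₀ c, ⟨⟨?_, ?_, ?_, ?_⟩, ?_⟩, fun s hs => Set.subset_sUnion_of_mem hs⟩
    · rintro K ⟨C, hC, hK⟩; exact (hc hC).1.isCompact K hK
    · rintro K ⟨C, hC, hK⟩; exact (hc hC).1.isConnected K hK
    · rintro K ⟨C, hC, hK⟩; exact (hc hC).1.nontrivial K hK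
    · exact (Set.pairwise_sUnion hchain.directedOn).2 fun C hC => (hc hC).1.disjoint
    · rintro K ⟨C, hC, hK⟩; exact (hc hC).2 K hK)
  refine ⟨M, hM.prop.1, hM.prop.2, fun L hL hLc hLn hLS => ?_⟩
  by_contra! h
  have hdis : ∀ K ∈ M, Disjoint L K := fun K hK => Set.disjoint_iff_inter_eq_empty.2 (h K hK)
  have hmem : insert L M ∈ {C : Set (Set Y) | IsDisjointContinuumFamily C ∧
      ∀ K ∈ C, Disjoint K S} := by
    refine ⟨⟨?_, ?_, ?_, ?_⟩, ?_⟩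
    · rintro K (rfl | hK); exacts [hL, hM.prop.1.isCompact K hK]
    · rintro K (rfl | hK); exacts [hLc, hM.prop.1.isConnected K hK]
    · rintro K (rfl | hK); exacts [hLn, hM.prop.1.nontrivial K hK]
    · exact hM.prop.1.disjoint.insert fun K hK _ => hdis K hK
    · rintro K (rfl | hK); exacts [hLS, hM.prop.2 K hK]
  have hLM : L ∈ M := hM.le_of_ge hmem (Set.subset_insert L M) (Set.mem_insert L M)
  exact hLn.nonempty.ne_empty (disjoint_self.1 (hdis L hLM))

section

variable {X Y : Type u} [TopologicalSpace X] [CompactSpace X] [TopologicalSpace Y]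
  [CompactSpace Y] [T2Space Y] [ConnectedSpace Y] [Nontrivial Y]

/-- The decomposition of `X ⊆ Y` into components of fibres of at most `continuumSln Y` functions is
separated by at most `continuumSln Y` saturated open sets. -/
theorem exists_saturated_separating_family {e : X → Y} (he : IsEmbedding e) {G : Set C(X, ℝ)}
    (hG : #G ≤ continuumSln Y) :
    ∃ P : Set (Set X), #P ≤ continuumSln Y ∧ (∀ D ∈ P, IsOpen D) ∧
      (∀ D ∈ P, ∀ x y, componentSetoid G x y → x ∈ D → y ∈ D) ∧
      ∀ x y, ¬ componentSetoid G x y → ∃ D ∈ P, ∃ D' ∈ P, x ∈ D ∧ y ∈ D' ∧ Disjoint D D' := by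
  have hκ := aleph0_le_continuumSln Y
  have hec : IsClosedEmbedding e := ⟨he, (isCompact_range he.continuous).isClosed⟩
  obtain ⟨M, hM, hMS, hMmax⟩ := exists_maximal_family_disjoint (Set.range e)
  have hW : ∀ K : M, ∃ U, IsOpen U ∧ Set.range e ⊆ U ∧ Disjoint (closure U) K.1 := fun K => by
    obtain ⟨U, hU, hSU, hUK⟩ := normal_exists_closure_subset hec.isClosed_range
      (hM.isCompact K K.2).isClosed.isOpen_compl
      (Set.disjoint_left.1 (hMS K K.2).symm)
    exact ⟨U, hU, hSU, Set.disjoint_left.2 hUK⟩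
  choose U hU hSU hUM using hW
  have hext : ∀ g : C(X, ℝ), ∃ h : C(Y, ℝ), ∀ x, h (e x) = g x := fun g => by
    obtain ⟨h, hh⟩ := g.exists_extension hec
    exact ⟨h, fun x => congrArg (fun k : C(X, ℝ) => k x) hh⟩
  choose E hE using hext
  -- The indices in `M` force continua into X; the rational intervals force the functions in `G` to
  -- be constant.
  let T : M ⊕ (G × (ℚ × ℚ)) → Set Y := Sum.elim (fun K => closure (U K))
    fun k => E k.1 ⁻¹' Set.Icc (k.2.1 : ℝ) k.2.2
  let O : M ⊕ (G × (ℚ × ℚ)) → Set Y := Sum.elim U fun k => E k.1 ⁻¹' Set.Ioo (k.2.1 : ℝ) k.2.2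
  have hT : ∀ i, IsClosed (T i) := by
    rintro (K | k)
    exacts [isClosed_closure, isClosed_Icc.preimage (E _).continuous]
  have hO : ∀ i, IsOpen (O i) := by
    rintro (K | k)
    exacts [hU K, isOpen_Ioo.preimage (E _).continuous]
  have hOT : ∀ i, O i ⊆ T i := by
    rintro (K | k)
    exacts [subset_closure, Set.preimage_mono Set.Ioo_subset_Icc_self]
  have hOsat : ∀ i x y, componentSetoid G x y → e x ∈ O i → e y ∈ O i := by
    rintro (K | ⟨g, a, b⟩) x y hxy hx
    · exact hSU K ⟨y, rfl⟩
    · have : E g (e x) ∈ Set.Ioo (a : ℝ) b := hx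
      rw [hE, ← componentSetoid_apply_eq hxy g.2, ← hE] at this
      exact this
  have hι : #(M ⊕ (G × (ℚ × ℚ))) ≤ continuumSln Y := by
    rw [mk_sum, mk_prod]
    simp only [Cardinal.lift_id, Cardinal.lift_uzero]
    refine add_le_of_le hκ hM.mk_le_continuumSln (mul_le_of_le hκ hG ?_)
    simpa using hκ
  obtain ⟨P, hP, hPform, hPsep⟩ := exists_clopen_piece_family hι hT hO hOT
  have hhalf : #(Set.range fun k : G × ℚ => {x | k.1.1 x < k.2} : Set (Set X)) ≤ continuumSln Y ∧
      #(Set.range fun k : G × ℚ => {x | k.2 < k.1.1 x} : Set (Set X)) ≤ continuumSln Y := by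
    have : #(G × ℚ) ≤ continuumSln Y := by
      rw [mk_prod]
      simp only [Cardinal.lift_uzero]
      exact mul_le_of_le hκ hG (by simpa using hκ)
    exact ⟨mk_range_le.trans this, mk_range_le.trans this⟩
  refine ⟨(e ⁻¹' ·) '' P ∪ ((Set.range fun k : G × ℚ => {x | k.1.1 x < k.2}) ∪
    Set.range fun k : G × ℚ => {x | k.2 < k.1.1 x}), ?_, ?_, ?_, ?_⟩
  · exact (mk_union_le _ _).trans (add_le_of_le hκ (mk_image_le.trans hP)
      ((mk_union_le _ _).trans (add_le_of_le hκ hhalf.1 hhalf.2)))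
  · rintro _ (⟨D, hD, rfl⟩ | ⟨⟨g, a⟩, rfl⟩ | ⟨⟨g, a⟩, rfl⟩)
    · obtain ⟨s, A, B, hA, hB, hAB, hun, rfl⟩ := hPform D hD
      -- This makes the piece open, although `A` is only relatively clopen in the intersection of
      -- the `T i`.
      have hAO : A ∩ ⋂ i ∈ s, O i = (⋂ i ∈ s, O i) \ B := by
        ext y
        constructor
        · rintro ⟨hyA, hyO⟩; exact ⟨hyO, Set.disjoint_left.1 hAB hyA⟩
        · rintro ⟨hyO, hyB⟩
          have : y ∈ A ∪ B := hun ▸ Set.iInter₂_mono (fun i _ => hOT i) hyO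
          exact ⟨this.resolve_right hyB, hyO⟩
      rw [hAO]
      exact ((isOpen_biInter_finset fun i _ => hO i).sdiff hB).preimage he.continuous
    · exact isOpen_lt g.1.continuous continuous_const
    · exact isOpen_lt continuous_const g.1.continuous
  · rintro _ (⟨D, hD, rfl⟩ | ⟨⟨g, a⟩, rfl⟩ | ⟨⟨g, a⟩, rfl⟩) x y hxy hx
    · obtain ⟨s, A, B, hA, hB, hAB, hun, rfl⟩ := hPform D hD
      obtain ⟨hxA, hxO⟩ := hx
      have hO' : ∀ z, componentSetoid G x z → e z ∈ ⋂ i ∈ s, O i := fun z hz =>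
        Set.mem_iInter₂.2 fun i hi => hOsat i x z hz (Set.mem_iInter₂.1 hxO i hi)
      refine ⟨?_, hO' y hxy⟩
      -- The class is connected and lies in `A ∪ B`, so it cannot leave `A`.
      refine (isConnected_componentClass.isPreconnected.image e
        he.continuous.continuousOn).subset_left_of_subset_union_closed hA hB hAB ?_
        ⟨e x, ⟨x, mem_componentClass_self (G := G), rfl⟩, hxA⟩ ⟨y, hxy, rfl⟩
      rintro _ ⟨z, hz, rfl⟩
      exact hun ▸ Set.iInter₂_mono (fun i _ => hOT i) (hO' z hz)
    · exact (componentSetoid_apply_eq hxy g.2).trans_lt hx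
    · exact lt_of_lt_of_eq hx (componentSetoid_apply_eq hxy g.2).symm
  · intro x y hxy
    by_cases hg : ∃ g ∈ G, g x ≠ g y
    · obtain ⟨g, hg, hne⟩ := hg
      rcases lt_or_gt_of_ne hne with hlt | hlt
      · obtain ⟨a, ha, ha'⟩ := exists_rat_btwn hlt
        exact ⟨_, Or.inr (Or.inl ⟨(⟨g, hg⟩, a), rfl⟩), _, Or.inr (Or.inr ⟨(⟨g, hg⟩, a), rfl⟩), ha,
          ha', Set.disjoint_left.2 fun z (hz : g z < a) (hz' : a < g z) => lt_asymm hz hz'⟩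
      · obtain ⟨a, ha, ha'⟩ := exists_rat_btwn hlt
        exact ⟨_, Or.inr (Or.inr ⟨(⟨g, hg⟩, a), rfl⟩), _, Or.inr (Or.inl ⟨(⟨g, hg⟩, a), rfl⟩), ha',
          ha, Set.disjoint_left.2 fun z (hz : a < g z) (hz' : g z < a) => lt_asymm hz hz'⟩
    · push Not at hg
      let J : Set (M ⊕ (G × (ℚ × ℚ))) := {i | e x ∈ O i}
      have hyJ : ∀ i ∈ J, e y ∈ O i := by
        rintro (K | ⟨g, a, b⟩) hi
        · exact hSU K ⟨y, rfl⟩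
        · have : E g (e x) ∈ Set.Ioo (a : ℝ) b := hi
          rw [hE, hg g g.2, ← hE] at this
          exact this
      -- Otherwise this component would be a continuum inside X on which every `g ∈ G` is constant,
      -- putting `x` and `y` in one class.
      have hnot : e y ∉ connectedComponentIn (⋂ i ∈ J, T i) (e x) := by
        intro hmem
        have hxF : e x ∈ ⋂ i ∈ J, T i := Set.mem_iInter₂.2 fun i hi => hOT i hi
        have hKc : IsCompact (connectedComponentIn (⋂ i ∈ J, T i) (e x)) :=
          isCompact_connectedComponentIn (isClosed_biInter fun i _ => hT i).isCompact _
        have hKn : (connectedComponentIn (⋂ i ∈ J, T i) (e x)).Nontrivial :=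
          ⟨e x, mem_connectedComponentIn hxF, e y, hmem, fun h => hxy (he.injective h ▸
            (componentSetoid G).refl x)⟩
        -- A point off X would give a small continuum off X, which meets some `K ∈ M` by maximality;
        -- but `closure (U K)` misses `K`.
        have hKS : connectedComponentIn (⋂ i ∈ J, T i) (e x) ⊆ Set.range e := by
          by_contra hsub
          obtain ⟨p, hp, hpS⟩ := Set.not_subset.1 hsub
          obtain ⟨L, hL, hLc, hLconn, hLn⟩ := exists_subcontinuum_subset hKc
            isPreconnected_connectedComponentIn hKn hec.isClosed_range.isOpen_compl ⟨p, hp, hpS⟩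
          obtain ⟨K, hK, z, hzL, hzK⟩ := hMmax L hLc hLconn hLn
            (Set.disjoint_left.2 fun z hz => (hL hz).2)
          have hzF := connectedComponentIn_subset _ _ (hL hzL).1
          have hz : z ∈ closure (U ⟨K, hK⟩) :=
            Set.mem_iInter₂.1 hzF (Sum.inl ⟨K, hK⟩) (hSU ⟨K, hK⟩ ⟨x, rfl⟩)
          exact Set.disjoint_left.1 (hUM ⟨K, hK⟩) hz hzK
        refine hxy ⟨e ⁻¹' connectedComponentIn (⋂ i ∈ J, T i) (e x), ?_,
          mem_connectedComponentIn hxF, hmem, fun g hgG z hz => ?_⟩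
        · rw [← he.isInducing.isPreconnected_image, Set.image_preimage_eq_of_subset hKS]
          exact isPreconnected_connectedComponentIn
        · have hzF := connectedComponentIn_subset _ _ hz
          have hbox : ∀ a b : ℚ, (a : ℝ) < g x → g x < b → (a : ℝ) ≤ g z ∧ g z ≤ b := by
            intro a b ha hb
            have : E g (e z) ∈ Set.Icc (a : ℝ) b :=
              Set.mem_iInter₂.1 hzF (Sum.inr (⟨g, hgG⟩, a, b)) (by
                change E g (e x) ∈ Set.Ioo (a : ℝ) b
                rw [hE]; exact ⟨ha, hb⟩)
            rwa [hE] at this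
          obtain ⟨a₀, ha₀⟩ := exists_rat_lt (g x)
          obtain ⟨b₀, hb₀⟩ := exists_rat_gt (g x)
          rcases lt_trichotomy (g z) (g x) with h | h | h
          · obtain ⟨a, ha, ha'⟩ := exists_rat_btwn h
            exact absurd (hbox a b₀ ha' hb₀).1 (not_le.2 ha)
          · exact h
          · obtain ⟨b, hb, hb'⟩ := exists_rat_btwn h
            exact absurd (hbox a₀ b ha₀ hb).2 (not_le.2 hb')
      obtain ⟨D, hD, D', hD', hx, hy, hd⟩ := hPsep J (e x) (e y) (fun i hi => hi) hyJ hnot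
      exact ⟨_, Or.inl ⟨D, hD, rfl⟩, _, Or.inl ⟨D', hD', rfl⟩, hx, hy, hd.preimage e⟩

end

/-! ### Weight of the quotients -/

theorem topWeight_le_of_isTopologicalBasis {Z : Type u} [TopologicalSpace Z] {B : Set (Set Z)}
    (hB : TopologicalSpace.IsTopologicalBasis B) : topWeight Z ≤ #B :=
  csInf_le' ⟨B, hB, rfl⟩

/-- A compact space is Hausdorff of weight at most `κ` if its points are separated by a family
of `κ` open sets. -/
theorem topWeight_le_of_separating {Z : Type u} [tZ : TopologicalSpace Z] [CompactSpace Z]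
    {κ : Cardinal.{u}} (hκ : ℵ₀ ≤ κ) {P : Set (Set Z)} (hP : #P ≤ κ) (hopen : ∀ D ∈ P, IsOpen D)
    (hsep : ∀ x y, x ≠ y → ∃ D ∈ P, ∃ D' ∈ P, x ∈ D ∧ y ∈ D' ∧ Disjoint D D') :
    topWeight Z ≤ κ := by
  have hle : tZ ≤ TopologicalSpace.generateFrom P := le_generateFrom hopen
  have ht2 : @T2Space Z (TopologicalSpace.generateFrom P) := by
    refine @T2Space.mk Z (TopologicalSpace.generateFrom P) fun x y hxy => ?_
    obtain ⟨D, hD, D', hD', hx, hy, hd⟩ := hsep x y hxy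
    exact ⟨D, D', .basic D hD, .basic D' hD', hx, hy, hd⟩
  -- A compact topology has no strictly coarser Hausdorff topology.
  have heq : tZ = TopologicalSpace.generateFrom P := by
    refine le_antisymm hle ?_
    have hc : @Continuous Z Z tZ (TopologicalSpace.generateFrom P) id := continuous_id_iff_le.2 hle
    have hcl := @Continuous.isClosedMap Z Z tZ (TopologicalSpace.generateFrom P) _ ht2 id hc
    intro U hU
    have := hcl Uᶜ hU.isClosed_compl
    rw [Set.image_id] at this
    simpa using @IsClosed.isOpen_compl Z (TopologicalSpace.generateFrom P) Uᶜ this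
  refine (topWeight_le_of_isTopologicalBasis
    (TopologicalSpace.isTopologicalBasis_of_subbasis heq)).trans ?_
  have hsurj : (fun f : Set (Set Z) => ⋂₀ f) '' {f | f.Finite ∧ f ⊆ P} ⊆
      Set.range fun s : Finset P => ⋂₀ (Subtype.val '' (s : Set P)) := by
    rintro _ ⟨f, ⟨hf, hfP⟩, rfl⟩
    have hfin : (Subtype.val ⁻¹' f : Set P).Finite := hf.preimage Subtype.val_injective.injOn
    refine ⟨hfin.toFinset, ?_⟩
    simp only [Set.Finite.coe_toFinset, Subtype.image_preimage_coe, Set.inter_eq_right.2 hfP]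
  exact (mk_le_mk_of_subset hsurj).trans (mk_range_le.trans (mk_finset_le_of_le hκ hP))

section

variable {X Y : Type u} [TopologicalSpace X] [CompactSpace X] [TopologicalSpace Y]
  [CompactSpace Y] [T2Space Y] [ConnectedSpace Y] [Nontrivial Y]

/-- The quotient of `X ⊆ Y` by the components of the fibres of at most `continuumSln Y` functions
is Hausdorff of weight at most `continuumSln Y`. -/
theorem t2Space_and_topWeight_quotient_componentSetoid {e : X → Y} (he : IsEmbedding e)
    {G : Set C(X, ℝ)} (hG : #G ≤ continuumSln Y) :
    T2Space (Quotient (componentSetoid G)) ∧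
      topWeight (Quotient (componentSetoid G)) ≤ continuumSln Y := by
  obtain ⟨P, hP, hopen, hsat, hsep⟩ := exists_saturated_separating_family he hG
  have hpre : ∀ D ∈ P, Quotient.mk (componentSetoid G) ⁻¹' (Quotient.mk _ '' D) = D := by
    intro D hD
    refine subset_antisymm ?_ (Set.subset_preimage_image _ _)
    rintro y ⟨x, hx, hxy⟩
    exact hsat D hD x y (Quotient.exact hxy) hx
  have hopen' : ∀ D ∈ (Quotient.mk (componentSetoid G) '' ·) '' P, IsOpen D := by
    rintro _ ⟨D, hD, rfl⟩
    rw [← isQuotientMap_quotient_mk'.isOpen_preimage]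
    exact (hpre D hD).symm ▸ hopen D hD
  have hsep' : ∀ z w : Quotient (componentSetoid G), z ≠ w →
      ∃ D ∈ (Quotient.mk (componentSetoid G) '' ·) '' P,
      ∃ D' ∈ (Quotient.mk (componentSetoid G) '' ·) '' P, z ∈ D ∧ w ∈ D' ∧ Disjoint D D' := by
    intro z w
    induction z using Quotient.inductionOn with | h x => ?_
    induction w using Quotient.inductionOn with | h y => ?_
    intro hne
    obtain ⟨D, hD, D', hD', hx, hy, hd⟩ := hsep x y fun h => hne (Quotient.sound h)
    refine ⟨_, ⟨D, hD, rfl⟩, _, ⟨D', hD', rfl⟩, ⟨x, hx, rfl⟩, ⟨y, hy, rfl⟩, ?_⟩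
    rw [Set.disjoint_left]
    rintro _ ⟨a, ha, rfl⟩ hb
    have : a ∈ Quotient.mk (componentSetoid G) ⁻¹' (Quotient.mk _ '' D') := hb
    rw [hpre D' hD'] at this
    exact Set.disjoint_left.1 hd ha this
  refine ⟨⟨fun z w hzw => ?_⟩, topWeight_le_of_separating (aleph0_le_continuumSln Y)
    (mk_image_le.trans hP) hopen' hsep'⟩
  obtain ⟨D, hD, D', hD', h⟩ := hsep' z w hzw
  exact ⟨D, D', hopen' D hD, hopen' D' hD', h⟩

end

/-! ### The transfinite chain of function families -/

theorem exists_transfinite_union {A W : Type*} [LinearOrder W] [WellFoundedLT W]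
    (N : Set A → Set A) : ∃ G : W → Set A, ∀ a, G a = ⋃ b : Set.Iio a, G b ∪ N (G b) :=
  ⟨wellFounded_lt.fix fun a ih => ⋃ b : Set.Iio a, ih b.1 b.2 ∪ N (ih b.1 b.2), fun a => by
    rw [WellFounded.fix_eq]⟩

section

variable {X Y : Type u} [TopologicalSpace X] [CompactSpace X] [T2Space X] [TopologicalSpace Y]
  [CompactSpace Y] [T2Space Y] [ConnectedSpace Y] [Nontrivial Y]

/-- Nondegenerate classes are disjoint continua, hence at most κ in number; one Urysohn function for
each suffices. -/
theorem exists_splitting_functions {X Y : Type u} [TopologicalSpace X] [CompactSpace X] [T2Space X]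
    [TopologicalSpace Y] {e : X → Y} (he : IsEmbedding e) (G : Set C(X, ℝ)) :
    ∃ N : Set C(X, ℝ), #N ≤ continuumSln Y ∧
      ∀ x, (componentClass G x).Nontrivial → ∃ h ∈ N, ∃ y ∈ componentClass G x, h y ≠ h x := by
  let I : Set (Set X) := {K | K.Nontrivial ∧ K ∈ Set.range (componentClass G)}
  have hI : #I ≤ continuumSln Y := by
    refine mk_le_continuumSln_of_disjoint he.continuous he.injective (fun K : I => K.1)
      ?_ ?_ (fun K => K.2.1) ?_
    · rintro ⟨_, -, x, rfl⟩; exact isClosed_componentClass.isCompact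
    · rintro ⟨_, -, x, rfl⟩; exact isConnected_componentClass
    · rintro ⟨_, _, x, rfl⟩ ⟨_, _, y, rfl⟩ hne
      refine Set.disjoint_left.2 fun z hx hy => hne (Subtype.ext ?_)
      have hxy : componentSetoid G x y := (componentSetoid G).trans hx ((componentSetoid G).symm hy)
      exact Set.ext fun w => ⟨fun h => (componentSetoid G).trans ((componentSetoid G).symm hxy) h,
        fun h => (componentSetoid G).trans hxy h⟩
  have hsep : ∀ K : I, ∃ h : C(X, ℝ), ∃ a ∈ K.1, ∃ b ∈ K.1, h a ≠ h b := by
    rintro ⟨K, ⟨a, ha, b, hb, hab⟩, -⟩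
    obtain ⟨h, h0, h1, -⟩ := exists_continuous_zero_one_of_isClosed (isClosed_singleton (x := a))
      (isClosed_singleton (x := b)) (Set.disjoint_singleton.2 hab)
    refine ⟨h, a, ha, b, hb, ?_⟩
    rw [h0 rfl, h1 rfl]
    simp
  choose h hh using hsep
  refine ⟨Set.range h, mk_range_le.trans hI, fun x hx => ⟨_, ⟨⟨_, hx, x, rfl⟩, rfl⟩, ?_⟩⟩
  obtain ⟨a, ha, b, hb, hab⟩ := hh ⟨_, hx, x, rfl⟩
  by_contra! hcon
  exact hab ((hcon a ha).trans (hcon b hb).symm)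

/-- Transfinitely splitting all nondegenerate classes separates the points of `X` before the
successor of `continuumSln Y`. -/
theorem exists_separating_chain {e : X → Y} (he : IsEmbedding e) :
    ∃ G : (Order.succ (continuumSln Y)).ord.ToType → Set C(X, ℝ), Monotone G ∧
      (∀ a, #(G a) ≤ continuumSln Y) ∧ ∀ x y, (∀ a, componentSetoid (G a) x y) → x = y := by
  have hκ := aleph0_le_continuumSln Y
  choose N hN hsplit using exists_splitting_functions (X := X) he
  obtain ⟨G, hG⟩ := exists_transfinite_union (W := (Order.succ (continuumSln Y)).ord.ToType) N
  have hlt : ∀ {a b}, b < a → G b ∪ N (G b) ⊆ G a := fun {a b} h => by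
    rw [hG a]
    exact Set.subset_iUnion (fun b : Set.Iio a => G b ∪ N (G b)) ⟨b, h⟩
  have hmono : Monotone G := fun b a h => by
    rcases h.eq_or_lt with rfl | h
    · exact subset_rfl
    · exact Set.subset_union_left.trans (hlt h)
  refine ⟨G, hmono, fun a => ?_, fun x y hxy => ?_⟩
  · induction a using WellFoundedLT.induction with
    | ind a ih =>
      rw [hG a]
      refine mk_iUnion_le_of_le hκ ?_ fun b => (mk_union_le _ _).trans
        (add_le_of_le hκ (ih b b.2) (hN _))
      -- Proper initial segments of κ⁺ have at most κ elements.
      have := mk_Iio_lt a (by simp)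
      rw [mk_ord_toType] at this
      exact Order.lt_succ_iff.1 this
  · by_contra hne
    have hnt : ∀ a, (componentClass (G a) x).Nontrivial := fun a =>
      ⟨x, mem_componentClass_self, y, hxy a, hne⟩
    -- Some `h` added after stage `a` varies on the class of `x`. A continuum in that class where `h
    -- ≠ h x` misses all later classes of `x`.
    have hL : ∀ a, ∃ L : Set X, L ⊆ componentClass (G a) x ∧
        (∀ b, a < b → Disjoint L (componentClass (G b) x)) ∧
        IsCompact L ∧ IsConnected L ∧ L.Nontrivial := by
      intro a
      obtain ⟨h, hh, z, hz, hzx⟩ := hsplit (G a) x (hnt a)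
      obtain ⟨L, hL, hL'⟩ := exists_subcontinuum_subset isClosed_componentClass.isCompact
        isConnected_componentClass.isPreconnected (hnt a)
        (isOpen_ne_fun h.continuous (continuous_const (y := h x))) ⟨z, hz, hzx⟩
      refine ⟨L, hL.trans Set.inter_subset_left, fun b hab => ?_, hL'⟩
      exact Set.disjoint_left.2 fun w hw hwb =>
        (hL hw).2 (componentSetoid_apply_eq hwb (hlt hab (Or.inr hh)))
    choose L hLK hLd hLc hLconn hLn using hL
    have := mk_le_continuumSln_of_disjoint he.continuous he.injective L hLc hLconn hLn
      fun a b hab => by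
        rcases lt_or_gt_of_ne hab with h | h
        · exact (hLd a b h).mono_right (hLK b)
        · exact ((hLd b a h).mono_right (hLK a)).symm
    rw [mk_ord_toType] at this
    exact (Order.lt_succ (continuumSln Y)).not_ge this

end

/-! ### The inverse spectrum and its limit -/

/-- The inverse spectrum of the quotients of `X` by the components of the fibres of an increasing
chain of families of functions. -/
def componentSpectrum {X : Type u} [TopologicalSpace X] {ι : Type v} [Preorder ι]
    (G : ι → Set C(X, ℝ)) (hG : Monotone G) : InverseSpectrum.{u, v} ι where
  space a := Quotient (componentSetoid (G a))
  topology _ := inferInstance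
  bond _ _ h := Quotient.map id fun _ _ hxy => componentSetoid_anti (hG h) hxy
  continuous_bond _ _ _ := continuous_quot_mk.quotient_lift _
  bond_self _ z := Quotient.inductionOn z fun _ => rfl
  bond_bond _ _ _ _ _ z := Quotient.inductionOn z fun _ => rfl

theorem isMonotoneMap_componentSpectrum_bond {X : Type u} [TopologicalSpace X] {ι : Type v}
    [Preorder ι] {G : ι → Set C(X, ℝ)} (hG : Monotone G) {a b : ι} (h : a ≤ b) :
    IsMonotoneMap ((componentSpectrum G hG).bond h) := by
  refine ⟨(componentSpectrum G hG).continuous_bond h, fun z => ?_⟩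
  obtain ⟨x, rfl⟩ := Quotient.exists_rep z
  -- The fibre of a bond is the image of a coarser class, which is connected.
  have : (componentSpectrum G hG).bond h ⁻¹' {Quotient.mk (componentSetoid (G a)) x} =
      Quotient.mk (componentSetoid (G b)) '' componentClass (G a) x := by
    ext w
    constructor
    · obtain ⟨y, rfl⟩ := Quotient.exists_rep w
      intro hy
      have hy' : Quotient.mk (componentSetoid (G a)) y = Quotient.mk (componentSetoid (G a)) x := hy
      exact ⟨y, (componentSetoid (G a)).symm (Quotient.exact hy'), rfl⟩
    · rintro ⟨y, hy, rfl⟩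
      exact (Quotient.sound ((componentSetoid (G a)).symm hy) :
        Quotient.mk (componentSetoid (G a)) y = Quotient.mk (componentSetoid (G a)) x)
  exact this ▸ isConnected_componentClass.image _ continuous_quot_mk.continuousOn

theorem nonempty_homeomorph_componentSpectrum_limit {X : Type u} [TopologicalSpace X]
    [CompactSpace X] {ι : Type v} [LinearOrder ι] [Nonempty ι] {G : ι → Set C(X, ℝ)}
    (hG : Monotone G) (ht2 : ∀ a, T2Space ((componentSpectrum G hG).space a))
    (hsep : ∀ x y, (∀ a, componentSetoid (G a) x y) → x = y) :
    Nonempty (X ≃ₜ (componentSpectrum G hG).limit) := by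
  let f : X → (componentSpectrum G hG).limit := fun x =>
    ⟨fun a => Quotient.mk (componentSetoid (G a)) x, fun _ _ _ => rfl⟩
  have hf : Continuous f := Continuous.subtype_mk (continuous_pi fun a => continuous_quot_mk) _
  have hinj : Function.Injective f := fun x y hxy =>
    hsep x y fun a => Quotient.exact (congrFun (congrArg Subtype.val hxy) a)
  have hsurj : Function.Surjective f := by
    rintro ⟨z, hz⟩
    let F : ι → Set X := fun a =>
      (fun x => (Quotient.mk (componentSetoid (G a)) x : (componentSpectrum G hG).space a)) ⁻¹' {z a}
    have hF : ∀ a, IsClosed (F a) := fun a => (isClosed_singleton (x := z a)).preimage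
      continuous_quot_mk
    have hanti : Antitone F := fun a b hab x hx => by
      have hx' : (Quotient.mk (componentSetoid (G b)) x : (componentSpectrum G hG).space b) = z b :=
        hx
      have := hz hab
      rw [← hx'] at this
      exact this
    -- The classes chosen by a thread form a decreasing chain of nonempty compact sets; a common
    -- point maps to the thread.
    obtain ⟨x, hx⟩ := IsCompact.nonempty_iInter_of_directed_nonempty_isCompact_isClosed F
      hanti.directed_ge (fun a => by
        obtain ⟨x, hx⟩ := Quotient.exists_rep (s := componentSetoid (G a)) (z a)
        exact ⟨x, hx⟩) (fun a => (hF a).isCompact) hF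
    exact ⟨x, Subtype.ext (funext fun a => Set.mem_iInter.1 hx a)⟩
  exact ⟨hf.homeoOfEquivCompactToT2 (f := Equiv.ofBijective f ⟨hinj, hsurj⟩)⟩

theorem mainTheorem3 (X : Type u) [TopologicalSpace X] [CompactSpace X] [T2Space X] [Nontrivial X]
    (hX : Sln X < topWeight X) :
    ∃ S : InverseSpectrum.{u, u + 1} (Set.Iio (Order.succ (Sln X)).ord),
      (∀ α, CompactSpace (S.space α)) ∧
      (∀ α, T2Space (S.space α)) ∧
      (∀ α, topWeight (S.space α) ≤ Sln X) ∧
      (∀ ⦃α β : Set.Iio (Order.succ (Sln X)).ord⦄ (h : α ≤ β), IsMonotoneMap (S.bond h)) ∧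
      Nonempty (X ≃ₜ S.limit) := by
  obtain ⟨Y, _, _, _, _, e, he, hY⟩ := csInf_mem (slnSet_nonempty X)
  change continuumSln Y = Sln X at hY
  have : Nontrivial Y := he.injective.nontrivial
  rw [← hY]
  obtain ⟨G, hG, hcard, hsep⟩ := exists_separating_chain (X := X) he
  -- The chain is indexed by a type in universe `u`, where its cardinality is compared with κ,
  -- whereas the ordinals below κ⁺ form a type in universe `u + 1`.
  let φ := Ordinal.ToType.mk (o := (Order.succ (continuumSln Y)).ord)
  have hGφ : Monotone fun a => G (φ a) := hG.comp φ.monotone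
  have : Nonempty (Set.Iio (Order.succ (continuumSln Y)).ord) :=
    ⟨⟨0, lt_ord.2 (by rw [card_zero]; exact bot_lt_of_lt (Order.lt_succ (continuumSln Y)))⟩⟩
  have ht2 : ∀ a, T2Space ((componentSpectrum _ hGφ).space a) := fun a =>
    (t2Space_and_topWeight_quotient_componentSetoid he (hcard (φ a))).1
  refine ⟨componentSpectrum _ hGφ, fun a => ?_, ht2, fun a =>
    (t2Space_and_topWeight_quotient_componentSetoid he (hcard (φ a))).2,
    fun a b h => isMonotoneMap_componentSpectrum_bond hGφ h,
    nonempty_homeomorph_componentSpectrum_limit hGφ ht2 fun x y h => hsep x y fun a => ?_⟩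
  · exact inferInstanceAs (CompactSpace (Quotient (componentSetoid (G (φ a)))))
  · have := h (φ.symm a)
    rwa [φ.apply_symm_apply] at this
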